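/- Let $\mathbb{T}=\mathbb{R}/\mathbb{Z}$ with Lebesgue measure, and let $\phi(x)=\frac1x+\frac1{1-x}$ for $x\in(0,1)$, regarded as a function defined almost everywhere on $\mathbb{T}$ by identifying $\mathbb{T}$ with $[0,1)$. For $\alpha,\beta\in\mathbb{T}$ and $N\ge 1$ put $$S_N(\phi)(x)=\sum_{k=0}^{N-1}\phi(x+k\alpha),\qquad \Theta_N^\beta(x)=\frac{S_N(\phi)(x)}{S_N(\phi)(x-\beta)}.$$ Then there exists a set $Z\subset\mathbb{T}^2$ of full Lebesgue measure such that for every $(\alpha,\beta)\in Z$, $$\limsup_{N\to\infty}\Theta_N^\beta(x)=\infty\quad\text{and}\quad\liminf_{N\to\infty}\Theta_N^\beta(x)=0\qquad\text{for a.e. }x\in\mathbb{T}.$$ -/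

import Mathlib

noncomputable section

/-- The observable `φ(x) = 1/x + 1/(1-x)` on the circle `ℝ/ℤ`, where a point is identified with its
representative in `[0, 1)`. (At the single point `0`, where the formula is undefined, the
value is irrelevant for almost-everywhere statements.) -/
def phi (x : UnitAddCircle) : ℝ :=
  1 / (AddCircle.equivIco 1 0 x : ℝ) + 1 / (1 - (AddCircle.equivIco 1 0 x : ℝ))

/-- The rotation `R_α(x) = x + α` of the circle. -/
def circleRotation (α x : UnitAddCircle) : UnitAddCircle := x + α

/-- The ratio `Θ_N^β(x) = S_N(φ)(x) / S_N(φ)(x - β)` of Birkhoff sums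
`S_N(φ)(x) = ∑_{k=0}^{N-1} φ(R_α^k x)`. -/
def Theta (α β : UnitAddCircle) (N : ℕ) (x : UnitAddCircle) : ℝ :=
  birkhoffSum (circleRotation α) phi N x / birkhoffSum (circleRotation α) phi N (x - β)

end

open MeasureTheory Set Filter Topology ProbabilityTheory

/-! ### The observable -/

/-! Since `phi` has tails of order `1/t`, its Birkhoff sums stay below `C * n * log n` outside a set
of small measure, while single values above a multiple of `n * log n` occur infinitely often because
`∑ 1/(n log n)` diverges. Take `α` and two base points `x`, `y` independent and uniform. If the sum
at `x` were eventually less than `M` times that at `y`, each huge value `phi (x + n • α)` would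
force an unusually large sum at `y`, an event of probability at most `η` given `(α, x)`. The points
`x + n • α` are pairwise independent, so the second-moment bound `measureReal_le_of_inter_subset`
leaves measure at most `2 * η` for this; let `η → 0`. Taking `y = x - β` gives the limsup, and `-β`
gives the liminf. -/

theorem phi_coe {x : ℝ} (hx : x ∈ Ico (0 : ℝ) 1) :
    phi (x : UnitAddCircle) = 1 / x + 1 / (1 - x) := by
  have h : ((AddCircle.equivIco 1 0 (x : UnitAddCircle)) : ℝ) = x := by
    rw [AddCircle.equivIco_coe_eq (by simpa using hx)]
  rw [phi, h]

theorem phi_pos (z : UnitAddCircle) : 0 < phi z := by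
  have h := (AddCircle.equivIco 1 0 z).2
  have h1 : 0 < 1 / (1 - (AddCircle.equivIco 1 0 z : ℝ)) := one_div_pos.2 (by linarith [h.2])
  have h0 : 0 ≤ 1 / (AddCircle.equivIco 1 0 z : ℝ) := one_div_nonneg.2 h.1
  rw [phi]
  linarith

@[fun_prop]
theorem measurable_phi : Measurable phi := by
  have h : Measurable fun z : UnitAddCircle => ((AddCircle.equivIco 1 0 z) : ℝ) :=
    measurable_subtype_coe.comp (AddCircle.measurableEquivIco (1 : ℝ) 0).measurable
  unfold phi
  fun_prop

theorem volume_eq_volume_inter_Ioo {s : Set UnitAddCircle} (hs : MeasurableSet s) :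
    volume s = volume (((↑) : ℝ → UnitAddCircle) ⁻¹' s ∩ Ioo 0 1) := by
  have h := UnitAddCircle.measurePreserving_mk 0
  rw [zero_add] at h
  have hm := h.measurable hs
  rw [← h.measure_preimage hs.nullMeasurableSet, ← restrict_Ioo_eq_restrict_Ioc,
    Measure.restrict_apply hm]

/-- Lower bound for the tail of the distribution of `phi`. -/
theorem one_div_le_volume_lt_phi {t : ℝ} (ht : 1 ≤ t) :
    ENNReal.ofReal (1 / t) ≤ volume {z | t < phi z} := by
  have ht0 : 0 < t := by linarith
  rw [volume_eq_volume_inter_Ioo (measurableSet_lt measurable_const measurable_phi)]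
  calc ENNReal.ofReal (1 / t) = volume (Ioo 0 (1 / t)) := by simp
    _ ≤ _ := measure_mono fun x hx => by
      have hx1 : x < 1 := hx.2.trans_le (by rw [div_le_one ht0]; exact ht)
      refine ⟨?_, hx.1, hx1⟩
      have h1 : 0 < 1 / (1 - x) := one_div_pos.2 (by linarith)
      have h2 : t < 1 / x := by
        rw [lt_one_div ht0 hx.1]; exact hx.2
      simp only [mem_preimage, mem_ofPred_eq, phi_coe ⟨hx.1.le, hx1⟩]
      linarith

/-- Upper bound for the tail of the distribution of `phi`. -/
theorem volume_lt_phi_le {s : ℝ} (hs : 0 < s) :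
    volume {z | s < phi z} ≤ ENNReal.ofReal (4 / s) := by
  rw [volume_eq_volume_inter_Ioo (measurableSet_lt measurable_const measurable_phi)]
  calc _ ≤ volume (Ioo 0 (2 / s) ∪ Ioo (1 - 2 / s) 1) := measure_mono fun x hx => by
        obtain ⟨hx, hx0, hx1⟩ := hx
        simp only [mem_preimage, mem_ofPred_eq, phi_coe ⟨hx0.le, hx1⟩] at hx
        by_contra hcon
        simp only [mem_union, mem_Ioo, not_or, not_and, not_lt] at hcon
        have h1 := hcon.1 hx0
        have h2 : 2 / s ≤ 1 - x := by
          by_contra hlt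
          linarith [hcon.2 (by linarith)]
        have h3 : 1 / x ≤ s / 2 := by
          simpa using one_div_le_one_div_of_le (by positivity) h1
        have h4 : 1 / (1 - x) ≤ s / 2 := by
          simpa using one_div_le_one_div_of_le (by positivity) h2
        linarith
    _ ≤ volume (Ioo 0 (2 / s)) + volume (Ioo (1 - 2 / s) 1) := measure_union_le _ _
    _ = _ := by
        rw [Real.volume_Ioo, Real.volume_Ioo, ← ENNReal.ofReal_add (by simp; positivity)
          (by simp; positivity)]
        congr 1
        ring

theorem integral_one_div_add_one_div {d : ℝ} (hd : 0 < d) (hd2 : d ≤ 1 / 2) :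
    ∫ x in d..(1 - d), (1 / x + 1 / (1 - x)) = 2 * Real.log ((1 - d) / d) := by
  have h1 : 0 < 1 - d := by linarith
  have hi : IntervalIntegrable (fun x : ℝ => 1 / x) volume d (1 - d) :=
    intervalIntegral.intervalIntegrable_one_div
      (fun x hx => by rw [uIcc_of_le (by linarith)] at hx; linarith [hx.1]) continuousOn_id
  have hi' : IntervalIntegrable (fun x : ℝ => 1 / (1 - x)) volume d (1 - d) :=
    intervalIntegral.intervalIntegrable_one_div
      (fun x hx => by rw [uIcc_of_le (by linarith)] at hx; linarith [hx.2]) (by fun_prop)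
  rw [intervalIntegral.integral_add hi hi',
    intervalIntegral.integral_comp_sub_left (fun x : ℝ => 1 / x) 1, sub_sub_cancel,
    integral_one_div_of_pos hd h1]
  ring

/-- The integral of `phi` truncated at height `s` grows logarithmically in `s`. -/
theorem lintegral_phi_truncated_le {s : ℝ} (hs : 2 ≤ s) :
    ∫⁻ z in {z | phi z ≤ s}, ENNReal.ofReal (phi z) ≤ ENNReal.ofReal (2 * Real.log s) := by
  have hs0 : 0 < s := by linarith
  have hd : 0 < 1 / s := by positivity
  have hd2 : 1 / s ≤ 1 / 2 := one_div_le_one_div_of_le (by norm_num) hs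
  rw [← lintegral_indicator (measurableSet_le measurable_phi measurable_const),
    ← UnitAddCircle.lintegral_preimage 0, zero_add, ← restrict_Ioo_eq_restrict_Ioc]
  have hg : ∀ x ∈ Icc (1 / s) (1 - 1 / s), 0 ≤ 1 / x + 1 / (1 - x) := fun x hx => by
    have : 0 < x := hd.trans_le hx.1
    have : 0 < 1 - x := by linarith [hx.2]
    positivity
  have hcont : ContinuousOn (fun x : ℝ => 1 / x + 1 / (1 - x)) (Icc (1 / s) (1 - 1 / s)) :=
    ContinuousOn.add
      (continuousOn_const.div continuousOn_id fun x hx => (hd.trans_le hx.1).ne')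
      (continuousOn_const.div (by fun_prop) fun x hx => by linarith [hx.2])
  calc _ ≤ ∫⁻ x in Ioo (0 : ℝ) 1, (Icc (1 / s) (1 - 1 / s)).indicator
            (fun x => ENNReal.ofReal (1 / x + 1 / (1 - x))) x := by
        refine setLIntegral_mono' measurableSet_Ioo fun x hx => ?_
        rw [indicator_apply]
        split_ifs with h
        · have h' : phi (x : UnitAddCircle) ≤ s := h
          rw [phi_coe ⟨hx.1.le, hx.2⟩] at h' ⊢
          have hx' : 0 < 1 - x := by linarith [hx.2]
          have h1 : 0 < 1 / x := one_div_pos.2 hx.1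
          have h2 : 0 < 1 / (1 - x) := one_div_pos.2 hx'
          have h3 : 1 / s ≤ x := by rw [one_div_le hs0 hx.1]; linarith
          have h4 : 1 / s ≤ 1 - x := by rw [one_div_le hs0 hx']; linarith
          rw [indicator_of_mem (show x ∈ Icc (1 / s) (1 - 1 / s) from ⟨h3, by linarith⟩)]
        · exact bot_le
    _ ≤ ∫⁻ x in Icc (1 / s) (1 - 1 / s), ENNReal.ofReal (1 / x + 1 / (1 - x)) := by
        rw [← lintegral_indicator measurableSet_Icc]
        exact setLIntegral_le_lintegral _ _
    _ = ENNReal.ofReal (∫ x in (1 / s)..(1 - 1 / s), (1 / x + 1 / (1 - x))) := by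
        rw [intervalIntegral.integral_of_le (by linarith), ← integral_Icc_eq_integral_Ioc,
          ofReal_integral_eq_lintegral_ofReal (hcont.integrableOn_Icc)
            ((ae_restrict_iff' measurableSet_Icc).2 (ae_of_all _ hg))]
    _ ≤ _ := by
        rw [integral_one_div_add_one_div hd hd2]
        refine ENNReal.ofReal_le_ofReal (mul_le_mul_of_nonneg_left ?_ (by norm_num))
        refine Real.log_le_log (div_pos (by linarith) hd) ?_
        rw [div_le_iff₀ hd, mul_one_div_cancel hs0.ne']
        linarith

/-! ### Birkhoff sums -/

theorem circleRotation_iterate (α x : UnitAddCircle) (k : ℕ) :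
    (circleRotation α)^[k] x = x + k • α := by
  induction k with
  | zero => simp
  | succ k ih => rw [Function.iterate_succ_apply', ih, circleRotation, succ_nsmul, add_assoc]

theorem birkhoffSum_circleRotation (α x : UnitAddCircle) (n : ℕ) :
    birkhoffSum (circleRotation α) phi n x = ∑ k ∈ Finset.range n, phi (x + k • α) := by
  simp [birkhoffSum, circleRotation_iterate]

theorem birkhoffSum_phi_pos (α x : UnitAddCircle) {n : ℕ} (hn : n ≠ 0) :
    0 < birkhoffSum (circleRotation α) phi n x := by
  rw [birkhoffSum_circleRotation]
  exact Finset.sum_pos (fun _ _ => phi_pos _) (by simpa using hn)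

theorem phi_le_birkhoffSum_succ (α x : UnitAddCircle) (n : ℕ) :
    phi (x + n • α) ≤ birkhoffSum (circleRotation α) phi (n + 1) x := by
  rw [birkhoffSum_circleRotation]
  exact Finset.single_le_sum (f := fun k => phi (x + k • α)) (fun _ _ => (phi_pos _).le)
    (Finset.self_mem_range_succ n)

@[fun_prop]
theorem Measurable.birkhoffSum_phi {Ω : Type*} [MeasurableSpace Ω] {f g : Ω → UnitAddCircle}
    (hf : Measurable f) (hg : Measurable g) (n : ℕ) :
    Measurable fun p => birkhoffSum (circleRotation (f p)) phi n (g p) := by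
  simp only [birkhoffSum_circleRotation]
  fun_prop

/-- Markov's inequality for the Birkhoff sums of `phi`, after truncation at height `s`. -/
theorem volume_lt_birkhoffSum_le (α : UnitAddCircle) (n : ℕ) {s c : ℝ} (hs : 2 ≤ s) (hc : 0 < c) :
    volume {y | c < birkhoffSum (circleRotation α) phi n y} ≤
      ENNReal.ofReal (n * (4 / s) + n * (2 * Real.log s) / c) := by
  have hs0 : 0 < s := by linarith
  have hlog : 0 ≤ Real.log s := Real.log_nonneg (by linarith)
  set ψ : UnitAddCircle → ENNReal :=
    {z | phi z ≤ s}.indicator fun z => ENNReal.ofReal (phi z) with hψ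
  have hms : MeasurableSet {z | phi z ≤ s} := measurableSet_le measurable_phi measurable_const
  have hψm : Measurable ψ := measurable_phi.ennreal_ofReal.indicator hms
  have hψk : ∀ k : ℕ, ∫⁻ y, ψ (y + k • α) ≤ ENNReal.ofReal (2 * Real.log s) := fun k => by
    rw [lintegral_add_right_eq_self, hψ, lintegral_indicator hms]
    exact lintegral_phi_truncated_le hs
  -- Either some term exceeds `s` (union bound), or truncation changes nothing (Markov).
  have hsub : {y | c < birkhoffSum (circleRotation α) phi n y} ⊆
      (⋃ k ∈ Finset.range n, (· + k • α) ⁻¹' {z | s < phi z}) ∪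
        {y | ENNReal.ofReal c ≤ ∑ k ∈ Finset.range n, ψ (y + k • α)} := by
    intro y hy
    by_cases h : ∃ k ∈ Finset.range n, s < phi (y + k • α)
    · exact Or.inl (by simpa using h)
    · push Not at h
      right
      have : ∀ k ∈ Finset.range n, ψ (y + k • α) = ENNReal.ofReal (phi (y + k • α)) :=
        fun k hk => indicator_of_mem (s := {z | phi z ≤ s}) (h k hk) _
      rw [mem_ofPred_eq, birkhoffSum_circleRotation] at hy
      rw [mem_ofPred_eq, Finset.sum_congr rfl this,
        ← ENNReal.ofReal_sum_of_nonneg fun _ _ => (phi_pos _).le]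
      exact ENNReal.ofReal_le_ofReal hy.le
  refine (measure_mono hsub).trans ((measure_union_le _ _).trans ?_)
  rw [ENNReal.ofReal_add (by positivity) (by positivity)]
  refine add_le_add ?_ ?_
  · refine (measure_biUnion_finset_le _ _).trans ?_
    simp only [measure_preimage_add_right]
    rw [Finset.sum_const, Finset.card_range, nsmul_eq_mul, ENNReal.ofReal_mul (by positivity),
      ENNReal.ofReal_natCast]
    gcongr
    exact volume_lt_phi_le hs0
  · refine (meas_ge_le_lintegral_div (by fun_prop) (by simpa using hc)
      ENNReal.ofReal_ne_top).trans ?_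
    rw [ENNReal.ofReal_div_of_pos hc, lintegral_finsetSum _ (by fun_prop)]
    gcongr
    refine (Finset.sum_le_sum fun k _ => hψk k).trans ?_
    rw [Finset.sum_const, Finset.card_range, nsmul_eq_mul,
      ENNReal.ofReal_mul n.cast_nonneg, ENNReal.ofReal_natCast]

/-- The Birkhoff sums of `phi` are of order `n * log n` in probability, uniformly in the angle. -/
theorem exists_volume_lt_birkhoffSum_le {η : ℝ} (hη : 0 < η) :
    ∃ C > 0, ∀ᶠ n : ℕ in atTop, ∀ α : UnitAddCircle,
      volume {y | C * (n * Real.log n) < birkhoffSum (circleRotation α) phi n y} ≤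
        ENNReal.ofReal η := by
  -- Truncating at height `8 / η * n`, the union bound and Markov's inequality contribute `η / 2`
  -- each.
  refine ⟨8 / η, by positivity, ?_⟩
  filter_upwards [tendsto_natCast_atTop_atTop.eventually_ge_atTop (8 / η),
    tendsto_natCast_atTop_atTop.eventually_ge_atTop (η / 4), eventually_ge_atTop 2]
    with n h1 h2 h3 α
  have hn : (2 : ℝ) ≤ n := by exact_mod_cast h3
  have hl : 0 < Real.log n := Real.log_pos (by linarith)
  have hs : 2 ≤ 8 / η * n := by
    rw [div_mul_eq_mul_div, le_div_iff₀ hη]; linarith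
  refine (volume_lt_birkhoffSum_le α n hs (by positivity)).trans (ENNReal.ofReal_le_ofReal ?_)
  have hlog : Real.log (8 / η * n) ≤ 2 * Real.log n := by
    rw [Real.log_mul (by positivity) (by positivity)]
    linarith [Real.log_le_log (by positivity) h1]
  calc _ ≤ (n : ℝ) * (4 / (8 / η * n)) + n * (2 * (2 * Real.log n)) / (8 / η * (n * Real.log n)) := by
        gcongr
    _ = η := by field_simp; norm_num

/-! ### A quantitative Borel–Cantelli lemma for pairwise independent events -/

/-- Let `A n` be pairwise independent events with divergent sum of probabilities. If on `D` almost
every `A n` implies a comparatively rare event `F n`, then `D` has small measure. -/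
theorem measureReal_le_of_inter_subset {Ω : Type*} [MeasurableSpace Ω] {μ : Measure Ω}
    [IsProbabilityMeasure μ] {A F : ℕ → Set Ω} {D : Set Ω} {η : ℝ}
    (hA : ∀ n, MeasurableSet (A n)) (hF : ∀ n, MeasurableSet (F n))
    (hind : Pairwise fun i j =>
      IndepFun ((A i).indicator (1 : Ω → ℝ)) ((A j).indicator (1 : Ω → ℝ)) μ)
    (hsum : ¬ Summable fun n => μ.real (A n))
    (hD : ∀ᶠ n in atTop, D ∩ A n ⊆ F n)
    (hη : ∀ᶠ n in atTop, μ.real (F n) ≤ η * μ.real (A n)) :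
    μ.real D ≤ 2 * η := by
  obtain ⟨K, hK⟩ := eventually_atTop.1 (hD.and hη)
  -- On a block of indices with expected count `m ≥ R`, let `X` and `Y` count the events `A` and
  -- `F`. On `D`, `X ≤ Y`, so `X` is at most `m / 2` (Chebyshev) or `Y` is at least `m / 2`
  -- (Markov).
  have key : ∀ R : ℝ, 0 < R → μ.real D ≤ 4 / R + 2 * η := by
    intro R hR
    obtain ⟨L, hL⟩ : ∃ L, R ≤ ∑ i ∈ Finset.Ico K (K + L), μ.real (A i) := by
      have hsum' : ¬ Summable fun n => μ.real (A (n + K)) := by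
        rwa [summable_nat_add_iff (f := fun n => μ.real (A n)) K]
      have := (not_summable_iff_tendsto_nat_atTop_of_nonneg fun _ => measureReal_nonneg).1 hsum'
      obtain ⟨L, hL⟩ := (this.eventually_ge_atTop R).exists
      refine ⟨L, ?_⟩
      rw [Finset.sum_Ico_eq_sum_range]
      simpa [add_comm] using hL
    set I := Finset.Ico K (K + L)
    set m := ∑ i ∈ I, μ.real (A i) with hm
    have hm0 : 0 < m := hR.trans_le hL
    have hIK : ∀ i ∈ I, K ≤ i := fun i hi => (Finset.mem_Ico.1 hi).1
    set X : Ω → ℝ := ∑ i ∈ I, (A i).indicator 1 with hX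
    set Y : Ω → ℝ := ∑ i ∈ I, (F i).indicator 1 with hY
    have hmem : ∀ i, MemLp ((A i).indicator (1 : Ω → ℝ)) 2 μ := fun i =>
      memLp_indicator_const 2 (hA i) (1 : ℝ) (Or.inr (measure_ne_top _ _))
    have hint : ∀ {s : Set Ω}, MeasurableSet s → Integrable (s.indicator (1 : Ω → ℝ)) μ :=
      fun hs => (integrable_const (1 : ℝ)).indicator hs
    have hEX : μ[X] = m := by
      rw [hX, hm]
      simp only [Finset.sum_apply]
      rw [integral_finsetSum _ fun i _ => hint (hA i)]
      exact Finset.sum_congr rfl fun i _ => integral_indicator_one (hA i)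
    have hEY : μ[Y] ≤ η * m := by
      rw [hY, hm, Finset.mul_sum]
      simp only [Finset.sum_apply]
      rw [integral_finsetSum _ fun i _ => hint (hF i)]
      refine Finset.sum_le_sum fun i hi => ?_
      rw [integral_indicator_one (hF i)]
      exact (hK i (hIK i hi)).2
    have hYint : Integrable Y μ := integrable_finsetSum' _ fun i _ => hint (hF i)
    have hY0 : 0 ≤ Y := Finset.sum_nonneg fun i _ => indicator_nonneg fun _ _ => zero_le_one
    have hVar : variance X μ ≤ m := by
      rw [hX, IndepFun.variance_sum (fun i _ => hmem i) fun i _ j _ hij => hind hij, hm]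
      refine Finset.sum_le_sum fun i _ => ?_
      refine (variance_le_expectation_sq (hmem i).1).trans_eq ?_
      rw [← integral_indicator_one (hA i)]
      congr 1
      ext ω
      by_cases h : ω ∈ A i <;> simp [h]
    have hsub : D ⊆ {ω | m / 2 ≤ |X ω - μ[X]|} ∪ {ω | m / 2 ≤ Y ω} := by
      intro ω hω
      by_contra hcon
      simp only [mem_union, mem_ofPred_eq, not_or, not_le, hEX] at hcon
      have hXY : X ω ≤ Y ω := by
        simp only [hX, hY, Finset.sum_apply]
        refine Finset.sum_le_sum fun i hi => ?_
        by_cases h : ω ∈ A i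
        · simp [h, (hK i (hIK i hi)).1 ⟨hω, h⟩]
        · rw [indicator_of_notMem h]
          exact indicator_nonneg (fun _ _ => zero_le_one) _
      linarith [(abs_lt.1 hcon.1).1, hcon.2]
    refine (measureReal_mono hsub).trans ((measureReal_union_le _ _).trans (add_le_add ?_ ?_))
    · have h := meas_ge_le_variance_div_sq (μ := μ) (X := X)
        (memLp_finsetSum' _ fun i _ => hmem i) (half_pos hm0)
      have hle : variance X μ / (m / 2) ^ 2 ≤ 4 / R := by
        calc variance X μ / (m / 2) ^ 2 ≤ m / (m / 2) ^ 2 := by gcongr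
          _ = 4 / m := by field_simp; norm_num
          _ ≤ 4 / R := by gcongr
      exact ENNReal.toReal_le_of_le_ofReal (by positivity) (h.trans (ENNReal.ofReal_le_ofReal hle))
    · have h := mul_meas_ge_le_integral_of_nonneg (ae_of_all _ hY0) hYint (m / 2)
      have h2 : m / 2 * μ.real {ω | m / 2 ≤ Y ω} ≤ m / 2 * (2 * η) := by
        calc _ ≤ _ := h
          _ ≤ η * m := hEY
          _ = _ := by ring
      exact le_of_mul_le_mul_left h2 (half_pos hm0)
  have hlim : Tendsto (fun R : ℝ => 4 / R + 2 * η) atTop (𝓝 (0 + 2 * η)) :=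
    (tendsto_const_nhds.div_atTop tendsto_id).add_const _
  rw [zero_add] at hlim
  exact ge_of_tendsto hlim ((eventually_gt_atTop 0).mono key)

theorem not_summable_one_div_mul_log :
    ¬ Summable fun n : ℕ => 1 / ((n : ℝ) * Real.log n) := by
  -- Cauchy condensation reduces this to the harmonic series.
  rw [← summable_condensed_iff_of_eventually_nonneg]
  · have h : ∀ k : ℕ, (2 : ℝ) ^ k * (1 / (((2 ^ k : ℕ) : ℝ) * Real.log ((2 ^ k : ℕ) : ℝ))) =
        1 / Real.log 2 * (1 / (k : ℝ)) := fun k => by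
      push_cast
      rw [Real.log_pow]
      field_simp
    simp only [h]
    rw [summable_mul_left_iff (one_div_pos.2 (Real.log_pos one_lt_two)).ne']
    exact Real.not_summable_one_div_natCast
  · filter_upwards with n
    exact one_div_nonneg.2 (mul_nonneg n.cast_nonneg (Real.log_natCast_nonneg n))
  · filter_upwards [eventually_ge_atTop 2] with n hn
    have hn' : (2 : ℝ) ≤ n := by exact_mod_cast hn
    have hl : 0 < Real.log n := Real.log_pos (by linarith)
    push_cast
    gcongr <;> linarith

/-! ### Independence of the orbit points -/

instance isProbabilityMeasure_volume_unitAddCircle :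
    IsProbabilityMeasure (volume : Measure UnitAddCircle) :=
  ⟨UnitAddCircle.measure_univ⟩

/-- For distinct `n`, `m`, the orbit points `x + n • α` and `x + m • α` are independent and
uniformly distributed when `(α, x)` is. -/
theorem measurePreserving_orbit_pair {n m : ℕ} (h : n ≠ m) :
    MeasurePreserving fun p : UnitAddCircle × UnitAddCircle => (p.2 + n • p.1, p.2 + m • p.1) := by
  have h1 : MeasurePreserving fun p : UnitAddCircle × UnitAddCircle => (p.1, p.2 + n • p.1) :=
    (MeasurePreserving.id volume).skew_product (g := fun a x => x + n • a) (by fun_prop)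
      (ae_of_all _ fun a => map_add_right_eq_self volume _)
  -- The second point is the first plus `(m - n) • α`, and a nonzero integer multiple of a uniform
  -- point is uniform.
  have h2 : MeasurePreserving fun p : UnitAddCircle × UnitAddCircle =>
      (p.1, p.1 + ((m : ℤ) - n) • p.2) :=
    (MeasurePreserving.id volume).skew_product (g := fun z a => z + ((m : ℤ) - n) • a)
      (by fun_prop)
      (ae_of_all _ fun z => ((measurePreserving_add_left volume z).comp
        (Measure.measurePreserving_zsmul volume (by omega))).map_eq)
  convert h2.comp (Measure.measurePreserving_swap.comp h1) using 1
  ext p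
  · rfl
  · simp [sub_smul]

theorem measurePreserving_orbit_point (n : ℕ) :
    MeasurePreserving fun p : UnitAddCircle × UnitAddCircle => p.2 + n • p.1 :=
  measurePreserving_fst.comp (measurePreserving_orbit_pair n.lt_succ_self.ne)

/-! ### Unbounded ratios -/

/-- For almost every angle `p.1.1` and almost every pair of base points `p.1.2`, `p.2`, the
Birkhoff sum at the first point infinitely often exceeds a given multiple of the one at the
second. -/
theorem ae_frequently_mul_birkhoffSum_le {M : ℝ} (hM : 0 < M) :
    ∀ᵐ p : (UnitAddCircle × UnitAddCircle) × UnitAddCircle, ∃ᶠ n in atTop,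
      M * birkhoffSum (circleRotation p.1.1) phi n p.2 ≤
        birkhoffSum (circleRotation p.1.1) phi n p.1.2 := by
  simp only [Filter.Frequently, not_le]
  suffices h : ∀ K : ℕ, volume {p : (UnitAddCircle × UnitAddCircle) × UnitAddCircle |
      ∀ n ≥ K, birkhoffSum (circleRotation p.1.1) phi n p.1.2 <
        M * birkhoffSum (circleRotation p.1.1) phi n p.2} = 0 by
    filter_upwards [ae_all_iff.2 fun K => measure_eq_zero_iff_ae_notMem.1 (h K)] with p hp hev
    obtain ⟨K, hK⟩ := eventually_atTop.1 hev
    exact hp K hK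
  intro K
  set D := {p : (UnitAddCircle × UnitAddCircle) × UnitAddCircle |
      ∀ n ≥ K, birkhoffSum (circleRotation p.1.1) phi n p.1.2 <
        M * birkhoffSum (circleRotation p.1.1) phi n p.2} with hDdef
  suffices h : ∀ η : ℝ, 0 < η → volume.real D ≤ 2 * η by
    rw [← measureReal_eq_zero_iff]
    refine le_antisymm (le_of_forall_pos_le_add fun ε hε => ?_) measureReal_nonneg
    linarith [h (ε / 2) (half_pos hε)]
  intro η hη
  obtain ⟨C, hC, hCev⟩ := exists_volume_lt_birkhoffSum_le hη
  -- The shift to `n + 1` is there because `phi (x + n • α)` is the last term of the sum of length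
  -- `n + 1`.
  set w : ℕ → ℝ := fun n => C * (((n + 1 : ℕ) : ℝ) * Real.log ((n + 1 : ℕ) : ℝ)) with hw
  set B : ℕ → Set UnitAddCircle := fun n => {z | M * w n < phi z} with hB
  have hBm : ∀ n, MeasurableSet (B n) := fun n => measurableSet_lt measurable_const measurable_phi
  set A : ℕ → Set ((UnitAddCircle × UnitAddCircle) × UnitAddCircle) := fun n =>
    (fun p => p.1.2 + n • p.1.1) ⁻¹' B n with hA
  set F : ℕ → Set ((UnitAddCircle × UnitAddCircle) × UnitAddCircle) := fun n =>
    A n ∩ {p | w n < birkhoffSum (circleRotation p.1.1) phi (n + 1) p.2} with hF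
  have hpair : ∀ {i j : ℕ}, i ≠ j → MeasurePreserving
      (fun p : (UnitAddCircle × UnitAddCircle) × UnitAddCircle =>
        (p.1.2 + i • p.1.1, p.1.2 + j • p.1.1)) := fun h =>
    (measurePreserving_orbit_pair h).comp measurePreserving_fst
  have hpt : ∀ i : ℕ, MeasurePreserving
      (fun p : (UnitAddCircle × UnitAddCircle) × UnitAddCircle => p.1.2 + i • p.1.1) := fun i =>
    (measurePreserving_orbit_point i).comp measurePreserving_fst
  have hAm : ∀ n, MeasurableSet (A n) := fun n => (hpt n).measurable (hBm n)
  have hGm : ∀ n, MeasurableSet {p : (UnitAddCircle × UnitAddCircle) × UnitAddCircle |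
      w n < birkhoffSum (circleRotation p.1.1) phi (n + 1) p.2} := fun n =>
    measurableSet_lt measurable_const (measurable_fst.fst.birkhoffSum_phi measurable_snd _)
  have hFm : ∀ n, MeasurableSet (F n) := fun n => (hAm n).inter (hGm n)
  have hAvol : ∀ n, volume.real (A n) = volume.real (B n) := fun n => by
    rw [measureReal_def, (hpt n).measure_preimage (hBm n).nullMeasurableSet, measureReal_def]
  have hwtop : Tendsto w atTop atTop := by
    have h := (tendsto_natCast_atTop_atTop (R := ℝ)).comp (tendsto_add_atTop_nat 1)
    exact (h.atTop_mul_atTop₀ (Real.tendsto_log_atTop.comp h)).const_mul_atTop hC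
  refine measureReal_le_of_inter_subset hAm hFm (fun i j hij => ?_) (fun hs => ?_) ?_ ?_
  · have hind : IndepFun (fun p : (UnitAddCircle × UnitAddCircle) × UnitAddCircle =>
        p.1.2 + i • p.1.1) (fun p => p.1.2 + j • p.1.1) volume := by
      rw [indepFun_iff_map_prod_eq_prod_map_map (hpt i).measurable.aemeasurable
        (hpt j).measurable.aemeasurable, (hpair hij).map_eq, (hpt i).map_eq, (hpt j).map_eq]
      rfl
    exact hind.comp (φ := (B i).indicator 1) (ψ := (B j).indicator 1)
      (measurable_one.indicator (hBm i)) (measurable_one.indicator (hBm j))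
  · have hlow : ∀ᶠ n in atTop, 1 / (M * w n) ≤ volume.real (A n) := by
      filter_upwards [hwtop.eventually_ge_atTop (1 / M)] with n hn
      have h1 : 1 ≤ M * w n := by
        rwa [div_le_iff₀' hM] at hn
      rw [hAvol]
      exact (ENNReal.ofReal_le_iff_le_toReal (measure_ne_top _ _)).1 (one_div_le_volume_lt_phi h1)
    have hw0 : ∀ n, 0 ≤ w n := fun n =>
      mul_nonneg hC.le (mul_nonneg (Nat.cast_nonneg _) (Real.log_natCast_nonneg _))
    have h1 : Summable fun n => 1 / (M * w n) := by
      refine Summable.of_norm_bounded_eventually_nat hs ?_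
      filter_upwards [hlow] with n hn
      rwa [Real.norm_of_nonneg (one_div_nonneg.2 (mul_nonneg hM.le (hw0 n)))]
    have h2 : Summable fun n : ℕ => 1 / (((n + 1 : ℕ) : ℝ) * Real.log ((n + 1 : ℕ) : ℝ)) := by
      refine (h1.mul_left (M * C)).congr fun n => ?_
      simp only [hw]
      field_simp
    exact not_summable_one_div_mul_log ((summable_nat_add_iff (f := fun n : ℕ =>
      1 / ((n : ℝ) * Real.log n)) 1).1 h2)
  · filter_upwards [eventually_ge_atTop K] with n hn
    rintro p ⟨hpD, hpA⟩
    refine ⟨hpA, ?_⟩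
    have h1 := hpD (n + 1) (by omega)
    have h2 : M * w n < phi (p.1.2 + n • p.1.1) := hpA
    have h3 := phi_le_birkhoffSum_succ p.1.1 p.1.2 n
    exact lt_of_mul_lt_mul_left (h2.trans_le (h3.trans h1.le)) hM.le
  · filter_upwards [(tendsto_add_atTop_nat 1).eventually hCev] with n hn
    suffices h : volume (F n) ≤ ENNReal.ofReal η * volume (A n) by
      have := ENNReal.toReal_mono (ENNReal.mul_ne_top ENNReal.ofReal_ne_top (measure_ne_top _ _)) h
      rwa [ENNReal.toReal_mul, ENNReal.toReal_ofReal hη.le] at this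
    -- Fubini over `q = (α, x)`: `A n` does not involve `y`, so its fibre is everything or empty,
    -- and the tail bound is uniform in `α`.
    rw [Measure.volume_eq_prod, Measure.prod_apply (hFm n), Measure.prod_apply (hAm n),
      ← lintegral_const_mul' _ _ ENNReal.ofReal_ne_top]
    refine lintegral_mono fun q => ?_
    by_cases hq : q.2 + n • q.1 ∈ B n
    · have e : Prod.mk q ⁻¹' A n = (univ : Set UnitAddCircle) := eq_univ_of_forall fun _ => hq
      dsimp only
      rw [e, measure_univ, mul_one]
      exact (measure_mono fun y hy => hy.2).trans (hn q.1)
    · have e : Prod.mk q ⁻¹' F n = (∅ : Set UnitAddCircle) :=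
        eq_empty_of_forall_notMem fun y hy => hq hy.1
      dsimp only
      rw [e, measure_empty]
      exact bot_le

/-! ### Passage to limsup and liminf -/

theorem limsup_coe_eq_top_of_frequently {u : ℕ → ℝ} (h : ∀ M : ℕ, ∃ᶠ n in atTop, (M : ℝ) ≤ u n) :
    limsup (fun n => (u n : EReal)) atTop = ⊤ := by
  rw [EReal.eq_top_iff_forall_lt]
  intro y
  obtain ⟨M, hM⟩ := exists_nat_gt y
  refine (EReal.coe_lt_coe_iff.2 hM).trans_le (le_limsup_of_frequently_le' ?_)
  exact (h M).mono fun n hn => EReal.coe_le_coe_iff.2 hn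

theorem liminf_coe_eq_zero_of_frequently {u : ℕ → ℝ} (h0 : ∀ n, 0 ≤ u n)
    (h : ∀ M : ℕ, ∃ᶠ n in atTop, (M : ℝ) ≤ (u n)⁻¹) :
    liminf (fun n => (u n : EReal)) atTop = 0 := by
  refine le_antisymm (le_of_forall_gt_imp_ge_of_dense fun y hy => ?_)
    (le_liminf_of_le (by isBoundedDefault) (Eventually.of_forall fun n =>
      EReal.coe_nonneg.2 (h0 n)))
  obtain ⟨r, hr0, hry⟩ := EReal.lt_iff_exists_real_btwn.1 hy
  have hr0' : 0 < r := EReal.coe_pos.1 hr0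
  obtain ⟨M, hM⟩ := exists_nat_gt r⁻¹
  refine liminf_le_of_frequently_le' ((h M).mono fun n hn => ?_)
  refine le_trans (EReal.coe_le_coe_iff.2 ?_) hry.le
  have hlt : r⁻¹ < (u n)⁻¹ := hM.trans_le hn
  by_contra hcon
  rw [not_le] at hcon
  exact absurd (inv_strictAnti₀ hr0' hcon) hlt.not_gt

theorem Theta_nonneg (α β : UnitAddCircle) (n : ℕ) (x : UnitAddCircle) : 0 ≤ Theta α β n x := by
  simp only [Theta, birkhoffSum_circleRotation]
  exact div_nonneg (Finset.sum_nonneg fun _ _ => (phi_pos _).le)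
    (Finset.sum_nonneg fun _ _ => (phi_pos _).le)

/-- Replacing `(x, β)` by `(x - β, -β)` exchanges the two base points; this turns large ratios into
small ones. -/
theorem Theta_neg_sub (α β : UnitAddCircle) (n : ℕ) (x : UnitAddCircle) :
    Theta α (-β) n (x - β) = (Theta α β n x)⁻¹ := by
  rw [Theta, Theta, inv_div, sub_neg_eq_add, sub_add_cancel]

/-- The change of variables `((α, β), x) ↦ ((α, x), x - β)`. -/
theorem measurePreserving_base_points :
    MeasurePreserving fun p : (UnitAddCircle × UnitAddCircle) × UnitAddCircle =>
      ((p.1.1, p.2), p.2 - p.1.2) := by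
  have h1 : MeasurePreserving fun p : (UnitAddCircle × UnitAddCircle) × UnitAddCircle =>
      ((p.1.1, p.2), p.1.2) :=
    ((measurePreserving_prodAssoc volume volume volume).symm _).comp
      (((MeasurePreserving.id volume).prod Measure.measurePreserving_swap).comp
        (measurePreserving_prodAssoc volume volume volume))
  have h2 : MeasurePreserving fun q : (UnitAddCircle × UnitAddCircle) × UnitAddCircle =>
      (q.1, q.1.2 - q.2) :=
    (MeasurePreserving.id volume).skew_product 
      (g := fun (a : UnitAddCircle × UnitAddCircle) b => a.2 - b) (by fun_prop)
      (ae_of_all _ fun a => (Measure.measurePreserving_sub_left volume a.2).map_eq)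
  exact h2.comp h1

theorem ae_frequently_le_Theta :
    ∀ᵐ q : UnitAddCircle × UnitAddCircle, ∀ᵐ x : UnitAddCircle,
      ∀ M : ℕ, ∃ᶠ n in atTop, (M : ℝ) ≤ Theta q.1 q.2 n x := by
  refine Measure.ae_ae_of_ae_prod (p := fun p : (UnitAddCircle × UnitAddCircle) × UnitAddCircle =>
    ∀ M : ℕ, ∃ᶠ n in atTop, (M : ℝ) ≤ Theta p.1.1 p.1.2 n p.2) (ae_all_iff.2 fun M => ?_)
  -- `M + 1` keeps the multiplier positive when `M = 0`.
  have h := measurePreserving_base_points.quasiMeasurePreserving.ae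
    (ae_frequently_mul_birkhoffSum_le (M := (M + 1 : ℝ)) (by positivity))
  filter_upwards [h] with p hp
  refine (hp.and_eventually (eventually_ne_atTop 0)).mono fun n hn => ?_
  have hpos := birkhoffSum_phi_pos p.1.1 (p.2 - p.1.2) hn.2
  rw [Theta, le_div_iff₀ hpos]
  exact le_trans (by gcongr; linarith) hn.1

theorem mainTheorem5 :
    ∃ Z : Set (UnitAddCircle × UnitAddCircle),
      MeasurableSet Z ∧ MeasureTheory.volume Zᶜ = 0 ∧
      ∀ α β : UnitAddCircle, (α, β) ∈ Z →
        ∀ᵐ x : UnitAddCircle ∂MeasureTheory.volume,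
          Filter.limsup (fun N : ℕ => ((Theta α β N x : ℝ) : EReal)) Filter.atTop = ⊤ ∧
          Filter.liminf (fun N : ℕ => ((Theta α β N x : ℝ) : EReal)) Filter.atTop = 0 := by
  have hneg : MeasurePreserving fun q : UnitAddCircle × UnitAddCircle => (q.1, -q.2) :=
    (MeasurePreserving.id volume).prod (Measure.measurePreserving_neg volume)
  have hae := ae_frequently_le_Theta.and (hneg.quasiMeasurePreserving.ae ae_frequently_le_Theta)
  -- The exceptional set need not be visibly measurable, so a measurable null superset is removed.
  obtain ⟨t, ht, htm, ht0⟩ := exists_measurable_superset_of_null (ae_iff.1 hae)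
  refine ⟨tᶜ, htm.compl, by rwa [compl_compl], fun α β hZ => ?_⟩
  obtain ⟨h1, h2⟩ := not_not.1 fun h => hZ (ht h)
  filter_upwards [h1, (measurePreserving_sub_right volume β).quasiMeasurePreserving.ae h2]
    with x hx1 hx2
  simp only [Theta_neg_sub] at hx2
  exact ⟨limsup_coe_eq_top_of_frequently hx1,
    liminf_coe_eq_zero_of_frequently (fun n => Theta_nonneg α β n x) hx2⟩
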